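/- Notation. A Boolean function is a function $f\colon\{0,1\}^n\to\{0,1\}$ with $n$ a positive integer, and $\neg f = 1-f$. - $D(f)$ is the minimum depth of a deterministic decision tree that computes $f(x)$ exactly for all $x\in\{0,1\}^n$ by querying bits of $x$. - $\mathrm{ndeg}(f)$ is the minimum degree of a multilinear polynomial $p\in\mathbb{R}[X_1,\dots,X_n]$ such that, for all $x\in\{0,1\}^n$, $p(x)\neq 0$ if and only if $f(x)=1$. - For $\epsilon\in[0,1)$, $\mathrm{ndeg}_\epsilon(f)$ is the minimum degree of a polynomial $p\in\mathbb{R}[X_1,\dots,X_n]$ such that, for all $x\in\{0,1\}^n$, $|p(x)|\le\epsilon$ if $f(x)=0$ and $|p(x)|\ge 1$ if $f(x)=1$. (The degree of the zero polynomial is taken to be $0$.) Theorem. For every $\epsilon\in[0,1)$ there is a constant $C$, depending only on $\epsilon$, such that for every positive integer $n$ and every Boolean function $f\colon\{0,1\}^n\to\{0,1\}$, $$D(f)\le C\cdot \mathrm{ndeg}_\epsilon(f)^2\,\mathrm{ndeg}(\neg f)^2\quad\text{and}\quad D(f)\le C\cdot \mathrm{ndeg}(f)^2\,\mathrm{ndeg}_\epsilon(\neg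 f)^2 .$$ -/

import Mathlib

noncomputable section

namespace BooleanComplexity

/-- A Boolean function `{0,1}^n → {0,1}`; `true` stands for `1` and `false` for `0`. -/
abbrev BoolFun (n : ℕ) : Type := (Fin n → Bool) → Bool

/-- The negation `¬f` of a Boolean function. -/
def neg {n : ℕ} (f : BoolFun n) : BoolFun n := fun x => !(f x)

/-- The point of `{0,1}^n ⊆ ℝ^n` given by a bit string. -/
def point {n : ℕ} (x : Fin n → Bool) : Fin n → ℝ := fun i => if x i then 1 else 0

/-- A real polynomial is multilinear if every variable has degree at most one in it. -/
def IsMultilinear {n : ℕ} (p : MvPolynomial (Fin n) ℝ) : Prop := ∀ i, p.degreeOf i ≤ 1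

/-- `p` is a nondeterministic representation of `f`: it is multilinear and, on the cube,
it is nonzero exactly where `f` takes the value `1`. -/
def IsNondetRep {n : ℕ} (f : BoolFun n) (p : MvPolynomial (Fin n) ℝ) : Prop :=
  IsMultilinear p ∧ ∀ x, MvPolynomial.eval (point x) p ≠ 0 ↔ f x = true

/-- The nondeterministic degree: the minimum degree of a nondeterministic representation. -/
def ndeg {n : ℕ} (f : BoolFun n) : ℕ :=
  sInf {d | ∃ p : MvPolynomial (Fin n) ℝ, IsNondetRep f p ∧ p.totalDegree = d}

/-- `p` is an `ε`-approximate nondeterministic representation of `f`: on the cube, `|p| ≤ ε`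
where `f` is `0`, and `|p| ≥ 1` where `f` is `1`. -/
def IsApproxNondetRep {n : ℕ} (ε : ℝ) (f : BoolFun n) (p : MvPolynomial (Fin n) ℝ) : Prop :=
  ∀ x, (f x = false → |MvPolynomial.eval (point x) p| ≤ ε) ∧
    (f x = true → 1 ≤ |MvPolynomial.eval (point x) p|)

/-- The `ε`-approximate nondeterministic degree: the minimum degree of a real polynomial that
is an `ε`-approximate nondeterministic representation. -/
def approxNdeg {n : ℕ} (ε : ℝ) (f : BoolFun n) : ℕ :=
  sInf {d | ∃ p : MvPolynomial (Fin n) ℝ, IsApproxNondetRep ε f p ∧ p.totalDegree = d}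

/-- Deterministic decision trees over `n` input bits. -/
inductive DecisionTree (n : ℕ) : Type
  | leaf (b : Bool) : DecisionTree n
  | query (i : Fin n) (ifZero ifOne : DecisionTree n) : DecisionTree n

/-- The output of a decision tree on an input. -/
def DecisionTree.eval {n : ℕ} (x : Fin n → Bool) : DecisionTree n → Bool
  | .leaf b => b
  | .query i s t => if x i then t.eval x else s.eval x

/-- The depth: the maximum number of queries on a path from the root to a leaf. -/
def DecisionTree.depth {n : ℕ} : DecisionTree n → ℕ
  | .leaf _ => 0
  | .query _ s t => max s.depth t.depth + 1

/-- The tree computes `f` exactly on every input. -/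
def DecisionTree.Computes {n : ℕ} (T : DecisionTree n) (f : BoolFun n) : Prop :=
  ∀ x, T.eval x = f x

/-- Decision tree complexity `D(f)`: the minimum depth of a decision tree computing `f`. -/
def D {n : ℕ} (f : BoolFun n) : ℕ :=
  sInf {d | ∃ T : DecisionTree n, T.Computes f ∧ T.depth = d}

/-! The three minima above are over nonempty sets, for every Boolean function. -/

/-- Every Boolean function agrees on the cube with a multilinear polynomial. -/
theorem exists_multilinear {n : ℕ} (f : BoolFun n) :
    ∃ p : MvPolynomial (Fin n) ℝ, IsMultilinear p ∧
      ∀ x, MvPolynomial.eval (point x) p = if f x then 1 else 0 := by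
  classical
  let g : (Fin n → Bool) → Fin n → MvPolynomial (Fin n) ℝ := fun y j =>
    if y j then MvPolynomial.X j else 1 - MvPolynomial.X j
  have hg : ∀ y i j, (g y j).degreeOf i ≤ if j = i then 1 else 0 := by
    intro y i j
    have hX : (MvPolynomial.X j : MvPolynomial (Fin n) ℝ).degreeOf i ≤ if j = i then 1 else 0 := by
      rw [MvPolynomial.degreeOf_X]
      simp [eq_comm]
    by_cases hy : y j
    · simpa [g, hy] using hX
    · simp only [g, hy]
      refine (MvPolynomial.degreeOf_sub_le i _ _).trans (max_le ?_ hX)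
      simp [MvPolynomial.degreeOf_one]
  refine ⟨∑ y with f y = true, ∏ j, g y j, ?_, ?_⟩
  · intro i
    refine (MvPolynomial.degreeOf_sum_le i _ _).trans (Finset.sup_le fun y _ => ?_)
    refine (MvPolynomial.degreeOf_prod_le i _ _).trans ?_
    refine (Finset.sum_le_sum fun j _ => hg y i j).trans ?_
    simp
  · intro x
    have hev : ∀ y, MvPolynomial.eval (point x) (∏ j, g y j) = if y = x then 1 else 0 := by
      intro y
      rw [map_prod]
      have : ∀ j, MvPolynomial.eval (point x) (g y j) = if y j = x j then 1 else 0 := by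
        intro j
        cases hy : y j <;> cases hx : x j <;> simp [g, point, hy, hx]
      simp only [this, Finset.prod_ite_zero, funext_iff]
      simp
    rw [map_sum]
    simp [hev]

theorem exists_nondetRep {n : ℕ} (f : BoolFun n) :
    ∃ p : MvPolynomial (Fin n) ℝ, IsNondetRep f p := by
  obtain ⟨p, hp, h⟩ := exists_multilinear f
  exact ⟨p, hp, fun x => by rw [h x]; simp⟩

theorem exists_approxNondetRep {n : ℕ} {ε : ℝ} (hε : 0 ≤ ε) (f : BoolFun n) :
    ∃ p : MvPolynomial (Fin n) ℝ, IsApproxNondetRep ε f p := by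
  obtain ⟨p, -, h⟩ := exists_multilinear f
  refine ⟨p, fun x => ⟨fun hx => ?_, fun hx => ?_⟩⟩ <;> rw [h x] <;> simp [hx, hε]

theorem exists_decisionTree {n : ℕ} (f : BoolFun n) :
    ∃ T : DecisionTree n, T.Computes f := by
  classical
  suffices H : ∀ (s : Finset (Fin n)) (z : Fin n → Bool), ∃ T : DecisionTree n,
      ∀ x, (∀ i, i ∉ s → x i = z i) → T.eval x = f x by
    obtain ⟨T, hT⟩ := H Finset.univ fun _ => false
    exact ⟨T, fun x => hT x fun i hi => absurd (Finset.mem_univ i) hi⟩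
  intro s
  induction s using Finset.induction_on with
  | empty =>
    intro z
    refine ⟨.leaf (f z), fun x hx => ?_⟩
    have : x = z := funext fun i => hx i (Finset.notMem_empty i)
    simp [DecisionTree.eval, this]
  | insert a s _ ih =>
    intro z
    obtain ⟨T0, h0⟩ := ih (Function.update z a false)
    obtain ⟨T1, h1⟩ := ih (Function.update z a true)
    refine ⟨.query a T0 T1, fun x hx => ?_⟩
    have key : ∀ b, x a = b → ∀ i, i ∉ s → x i = Function.update z a b i := by
      intro b hb i hi
      by_cases hia : i = a
      · subst hia; simp [hb]
      · rw [Function.update_of_ne hia]; exact hx i (by simp [hia, hi])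
    cases hxa : x a
    · simpa [DecisionTree.eval, hxa] using h0 x (key _ hxa)
    · simpa [DecisionTree.eval, hxa] using h1 x (key _ hxa)

end BooleanComplexity

end

/-!
By symmetry it suffices to prove the first inequality. Let `f` be nonconstant, let `p` approximate
`f` and let `q` be a nondeterministic representation of `¬f`. Where `|p|` is maximal on the cube,
say at `x`, the value of `f` is `1`. Suppose that changing `x` within each of `b` disjoint blocks
can turn `f` to `0`. Letting each of these changes be governed by one new variable turns `p` into a
polynomial in `b` variables, and the diagonal `t ↦ r(t, …, t)` of its multilinear reduction `r` is
bounded by `|p(x)|` on `[0, 1]`, being an average of values of `p` on the cube. Its derivative at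
`0` is the sum of the changes of `p`, so Markov's inequality gives `b (1 - ε) ≤ 2 (deg p)²`.

By the combinatorial Nullstellensatz, the bits in the support of any monomial of `q` of maximal
degree can be changed so that `q ≠ 0`, that is, `f = 0`. Hence a maximal disjoint family of such
monomials has at most `2 (deg p)² / (1 - ε)` members. Every monomial of maximal degree meets one of
them, so querying all their variables lowers the degree of `q`. Iterating this at most `deg q` times
makes `f` constant.
-/

noncomputable section

namespace BooleanComplexity

open Finset

section Markov

open Polynomial

variable {P : ℝ[X]} {d : ℕ} {M : ℝ}

theorem abs_eval_one_derivative_le (hd : P.natDegree ≤ d) (hM : 0 < M)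
    (hP : ∀ t ∈ Set.Icc (-1 : ℝ) 1, |P.eval t| ≤ M) :
    |P.derivative.eval 1| ≤ d ^ 2 * M := by
  have mul_le (a : ℝ) (ha : |a| = M⁻¹) : a * P.derivative.eval 1 ≤ d ^ 2 := by
    have hdeg : (C a * P).degree ≤ d :=
      natDegree_le_iff_degree_le.1 ((natDegree_C_mul_le a P).trans hd)
    have hbound : ∀ t ∈ Set.Icc (-1 : ℝ) 1, |(C a * P).eval t| ≤ 1 := fun t ht => by
      rw [eval_mul, eval_C, abs_mul, ha, inv_mul_le_iff₀ hM, mul_one]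
      exact hP t ht
    simpa [Chebyshev.derivative_T_eval_one] using
      Chebyshev.eval_iterate_derivative_le_of_forall_abs_le_one (k := 1) le_rfl hdeg hbound
  have hinv : |M⁻¹| = M⁻¹ := abs_of_pos (inv_pos.2 hM)
  have habs : |M⁻¹ * P.derivative.eval 1| ≤ d ^ 2 :=
    abs_le'.2 ⟨mul_le M⁻¹ hinv, by
      rw [← neg_mul]; exact mul_le (-M⁻¹) (by rw [abs_neg, hinv])⟩
  rwa [abs_mul, hinv, inv_mul_le_iff₀ hM, mul_comm] at habs

theorem abs_eval_zero_derivative_le (hd : P.natDegree ≤ d) (hM : 0 < M)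
    (hP : ∀ t ∈ Set.Icc (0 : ℝ) 1, |P.eval t| ≤ M) :
    |P.derivative.eval 0| ≤ 2 * d ^ 2 * M := by
  set L : ℝ[X] := C (1 / 2) * (1 - X) with hL
  have hLdeg : L.natDegree ≤ 1 := by rw [hL]; compute_degree
  have hdeg : (P.comp L).natDegree ≤ d :=
    natDegree_comp_le.trans ((Nat.mul_le_mul hd hLdeg).trans_eq (mul_one d))
  have hbound : ∀ t ∈ Set.Icc (-1 : ℝ) 1, |(P.comp L).eval t| ≤ M := fun t ht => by
    rw [eval_comp]
    refine hP _ ?_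
    simp only [hL, eval_mul, eval_C, eval_sub, eval_one, eval_X]
    constructor <;> linarith [ht.1, ht.2]
  have hderiv : (P.comp L).derivative.eval 1 = -(P.derivative.eval 0) / 2 := by
    simp only [hL, derivative_comp, derivative_mul, derivative_C, derivative_sub, derivative_one,
      derivative_X, eval_mul, eval_add, eval_sub, eval_comp, eval_C, eval_one, eval_X, eval_zero]
    ring_nf
  have := abs_eval_one_derivative_le hdeg hM hbound
  rw [hderiv, abs_div, abs_neg, abs_two] at this
  linarith

end Markov

section Diagonal

variable {ι R : Type*}

theorem card_support_le_degree (m : ι →₀ ℕ) : #m.support ≤ m.degree := by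
  rw [card_eq_sum_ones]
  exact sum_le_sum fun i hi => Nat.one_le_iff_ne_zero.2 (Finsupp.mem_support_iff.1 hi)

/-- The polynomial `t ↦ r(t, …, t)`, where `r` is the multilinear polynomial that agrees with `q`
on `{0,1}^ι`: reducing `q` modulo `X j ^ 2 = X j` turns a monomial into the product of the
variables of its support. -/
def diagonal [CommSemiring R] (q : MvPolynomial ι R) : Polynomial R :=
  ∑ m ∈ q.support, Polynomial.C (q.coeff m) * Polynomial.X ^ #m.support

theorem natDegree_diagonal_le [CommSemiring R] (q : MvPolynomial ι R) :
    (diagonal q).natDegree ≤ q.totalDegree := by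
  refine Polynomial.natDegree_sum_le_of_forall_le _ _ fun m hm => ?_
  calc (Polynomial.C (q.coeff m) * Polynomial.X ^ #m.support).natDegree
      ≤ #m.support := Polynomial.natDegree_C_mul_X_pow_le _ _
    _ ≤ m.degree := card_support_le_degree m
    _ ≤ q.totalDegree := MvPolynomial.le_totalDegree hm

theorem eval_indicator [CommSemiring R] [DecidableEq ι] (q : MvPolynomial ι R) (A : Finset ι) :
    q.eval (fun j => if j ∈ A then 1 else 0) =
      ∑ m ∈ q.support, if m.support ⊆ A then q.coeff m else 0 := by
  rw [MvPolynomial.eval_eq]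
  refine sum_congr rfl fun m _ => ?_
  have hpow : ∀ j ∈ m.support,
      (if j ∈ A then (1 : R) else 0) ^ m j = if j ∈ A then 1 else 0 := fun j hj => by
    rw [ite_pow, one_pow, zero_pow (Finsupp.mem_support_iff.1 hj)]
  rw [prod_congr rfl hpow, prod_ite_zero, prod_const_one, mul_ite, mul_one, mul_zero]
  rfl

theorem sum_pow_mul_pow_of_subset [CommRing R] [Fintype ι] [DecidableEq ι] (S : Finset ι) (t : R) :
    (∑ A : Finset ι, if S ⊆ A then t ^ #A * (1 - t) ^ #Aᶜ else 0) = t ^ #S := by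
  calc (∑ A : Finset ι, if S ⊆ A then t ^ #A * (1 - t) ^ #Aᶜ else 0)
      = ∑ A : Finset ι, (∏ _j ∈ A, t) * ∏ j ∈ Aᶜ, if j ∉ S then 1 - t else 0 := by
        refine sum_congr rfl fun A _ => ?_
        have hsub : S ⊆ A ↔ ∀ j ∈ Aᶜ, j ∉ S := by
          simp only [mem_compl, subset_iff, not_imp_not]
        rw [prod_ite_zero, prod_const, prod_const, mul_ite, mul_zero]
        simp only [hsub]
        congr
    _ = ∏ j, (t + if j ∉ S then 1 - t else 0) := by
        rw [prod_add, powerset_univ]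
        simp only [compl_eq_univ_sdiff]
    _ = ∏ j, if j ∈ S then t else 1 := by
        refine prod_congr rfl fun j _ => ?_
        by_cases hj : j ∈ S <;> simp [hj]
    _ = t ^ #S := by rw [prod_ite_mem, univ_inter, prod_const]

theorem eval_diagonal [CommRing R] [Fintype ι] [DecidableEq ι] (q : MvPolynomial ι R) (t : R) :
    (diagonal q).eval t = ∑ A : Finset ι,
      t ^ #A * (1 - t) ^ #Aᶜ * q.eval (fun j => if j ∈ A then 1 else 0) := by
  simp only [eval_indicator, mul_sum, diagonal, Polynomial.eval_finsetSum]
  rw [sum_comm]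
  refine sum_congr rfl fun m _ => ?_
  rw [Polynomial.eval_C_mul, Polynomial.eval_X_pow, ← sum_pow_mul_pow_of_subset, mul_sum]
  exact sum_congr rfl fun A _ => by rw [mul_ite, mul_ite, mul_zero, mul_zero, mul_comm]

theorem eval_zero_derivative_diagonal [CommRing R] [Fintype ι] [DecidableEq ι]
    (q : MvPolynomial ι R) :
    (diagonal q).derivative.eval 0 =
      ∑ j, (q.eval (fun k => if k ∈ ({j} : Finset ι) then 1 else 0) - q.eval 0) := by
  have hzero : q.eval 0 = ∑ m ∈ q.support, if m.support = ∅ then q.coeff m else 0 := by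
    simpa [← Pi.zero_def] using eval_indicator q ∅
  have hsub (S : Finset ι) (j : ι) (c : R) :
      ((if S ⊆ {j} then c else 0) - if S = ∅ then c else 0) = if S = {j} then c else 0 := by
    rcases eq_or_ne S ∅ with rfl | hS
    · simp [(singleton_ne_empty j).symm]
    · simp [subset_singleton_iff, hS]
  simp only [hzero, eval_indicator, ← sum_sub_distrib, hsub]
  rw [sum_comm, diagonal, Polynomial.derivative_sum, Polynomial.eval_finsetSum]
  refine sum_congr rfl fun m _ => ?_
  by_cases hcard : #m.support = 1
  · obtain ⟨k, hk⟩ := card_eq_one.1 hcard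
    simp [hk]
  · have hne (j : ι) : m.support ≠ {j} := fun h => hcard (h ▸ card_singleton j)
    rcases Nat.eq_zero_or_pos #m.support with h0 | hpos
    · simp [hne, h0]
    · have : #m.support - 1 ≠ 0 := by lia
      simp [hne, Polynomial.derivative_X_pow, this]

theorem abs_eval_diagonal_le [Finite ι] [DecidableEq ι] {q : MvPolynomial ι ℝ} {M t : ℝ}
    (hq : ∀ A : Finset ι, |q.eval (fun j => if j ∈ A then 1 else 0)| ≤ M)
    (ht : t ∈ Set.Icc (0 : ℝ) 1) : |(diagonal q).eval t| ≤ M := by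
  cases nonempty_fintype ι
  have hweight (A : Finset ι) : 0 ≤ t ^ #A * (1 - t) ^ #Aᶜ :=
    mul_nonneg (pow_nonneg ht.1 _) (pow_nonneg (sub_nonneg.2 ht.2) _)
  have hsum : ∑ A : Finset ι, t ^ #A * (1 - t) ^ #Aᶜ = 1 := by
    simpa using sum_pow_mul_pow_of_subset (∅ : Finset ι) t
  rw [eval_diagonal]
  calc |∑ A : Finset ι, t ^ #A * (1 - t) ^ #Aᶜ * q.eval (fun j => if j ∈ A then 1 else 0)|
      ≤ ∑ A : Finset ι, |t ^ #A * (1 - t) ^ #Aᶜ * q.eval (fun j => if j ∈ A then 1 else 0)| :=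
        abs_sum_le_sum_abs _ _
    _ ≤ ∑ A : Finset ι, t ^ #A * (1 - t) ^ #Aᶜ * M := sum_le_sum fun A _ => by
        rw [abs_mul, abs_of_nonneg (hweight A)]
        exact mul_le_mul_of_nonneg_left (hq A) (hweight A)
    _ = M := by rw [← sum_mul, hsum, one_mul]

theorem abs_sum_eval_indicator_sub_le [Fintype ι] [DecidableEq ι] {q : MvPolynomial ι ℝ} {M : ℝ}
    (hM : 0 < M) (hq : ∀ A : Finset ι, |q.eval (fun j => if j ∈ A then 1 else 0)| ≤ M) :
    |∑ j, (q.eval (fun k => if k ∈ ({j} : Finset ι) then 1 else 0) - q.eval 0)| ≤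
      2 * q.totalDegree ^ 2 * M := by
  rw [← eval_zero_derivative_diagonal]
  exact abs_eval_zero_derivative_le (natDegree_diagonal_le q) hM fun t => abs_eval_diagonal_le hq

end Diagonal

section Substitution

variable {σ ι R : Type*} [CommSemiring R]

theorem eval_bind₁ (g : σ → MvPolynomial ι R) (a : ι → R) (p : MvPolynomial σ R) :
    (MvPolynomial.bind₁ g p).eval a = p.eval fun i => (g i).eval a :=
  MvPolynomial.eval₂Hom_bind₁ (RingHom.id R) a g p

theorem totalDegree_bind₁_le {g : σ → MvPolynomial ι R} {k : ℕ} (hg : ∀ i, (g i).totalDegree ≤ k)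
    (p : MvPolynomial σ R) : (MvPolynomial.bind₁ g p).totalDegree ≤ p.totalDegree * k := by
  rw [← MvPolynomial.aeval_eq_bind₁, MvPolynomial.aeval_def, MvPolynomial.eval₂_eq,
    MvPolynomial.algebraMap_eq]
  refine MvPolynomial.totalDegree_finsetSum_le fun m hm => ?_
  calc (MvPolynomial.C (p.coeff m) * ∏ i ∈ m.support, g i ^ m i).totalDegree
      ≤ (∏ i ∈ m.support, g i ^ m i).totalDegree := by
        simpa using MvPolynomial.totalDegree_mul (MvPolynomial.C (p.coeff m)) _
    _ ≤ ∑ i ∈ m.support, (g i ^ m i).totalDegree := MvPolynomial.totalDegree_finsetProd _ _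
    _ ≤ ∑ i ∈ m.support, m i * k := sum_le_sum fun i _ =>
        (MvPolynomial.totalDegree_pow _ _).trans (Nat.mul_le_mul_left _ (hg i))
    _ = (∑ i ∈ m.support, m i) * k := (sum_mul _ _ _).symm
    _ ≤ p.totalDegree * k := Nat.mul_le_mul_right _ (MvPolynomial.le_totalDegree hm)

theorem abs_sum_eval_add_sub_le [Fintype ι] {p : MvPolynomial σ ℝ} {a : σ → ℝ} {v : ι → σ → ℝ}
    {M : ℝ} (hM : 0 < M) (hp : ∀ A : Finset ι, |p.eval (a + ∑ j ∈ A, v j)| ≤ M) :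
    |∑ j, (p.eval (a + v j) - p.eval a)| ≤ 2 * p.totalDegree ^ 2 * M := by
  classical
  let g (i : σ) : MvPolynomial ι ℝ :=
    MvPolynomial.C (a i) + ∑ j, MvPolynomial.C (v j i) * MvPolynomial.X j
  have hg (i : σ) : (g i).totalDegree ≤ 1 := by
    refine (MvPolynomial.totalDegree_add _ _).trans (max_le (by simp) ?_)
    refine MvPolynomial.totalDegree_finsetSum_le fun j _ => ?_
    exact (MvPolynomial.totalDegree_mul _ _).trans (by simp)
  have hdeg : (MvPolynomial.bind₁ g p).totalDegree ≤ p.totalDegree := by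
    simpa using totalDegree_bind₁_le hg p
  have heval (A : Finset ι) :
      (MvPolynomial.bind₁ g p).eval (fun j => if j ∈ A then 1 else 0) =
        p.eval (a + ∑ j ∈ A, v j) := by
    rw [eval_bind₁]
    congr 2 with i
    simp [g]
  have hsum := abs_sum_eval_indicator_sub_le hM fun A => (heval A).symm ▸ hp A
  have hzero : (MvPolynomial.bind₁ g p).eval 0 = p.eval a := by
    simpa [← Pi.zero_def] using heval ∅
  simp only [heval, hzero, sum_singleton] at hsum
  refine hsum.trans ?_
  gcongr

end Substitution

section Fix

variable {σ R : Type*} [CommSemiring R] [DecidableEq σ]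

/-- The substitution of the constants `a i` for the variables `X i` with `i ∈ H`, the effect on a
polynomial of querying `H`; the result is still a polynomial in all variables. -/
def fixVars (H : Finset σ) (a : σ → R) : MvPolynomial σ R →ₐ[R] MvPolynomial σ R :=
  MvPolynomial.bind₁ fun i => if i ∈ H then MvPolynomial.C (a i) else MvPolynomial.X i

theorem eval_fixVars (H : Finset σ) (a x : σ → R) (p : MvPolynomial σ R) :
    (fixVars H a p).eval x = p.eval (H.piecewise a x) := by
  rw [fixVars, eval_bind₁]
  congr 2 with i
  by_cases hi : i ∈ H <;> simp [hi]

theorem totalDegree_fixVars_le (H : Finset σ) (a : σ → R) (p : MvPolynomial σ R) :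
    (fixVars H a p).totalDegree ≤ p.totalDegree := by
  refine (totalDegree_bind₁_le (k := 1) (fun i => ?_) p).trans_eq (mul_one _)
  split_ifs
  · simp
  · exact (MvPolynomial.totalDegree_monomial_le (Finsupp.single i 1) (1 : R)).trans_eq (by simp)

theorem fixVars_monomial (H : Finset σ) (a : σ → R) (m : σ →₀ ℕ) (r : R) :
    fixVars H a (MvPolynomial.monomial m r) =
      MvPolynomial.monomial (m.filter (· ∉ H)) (r * ∏ i ∈ m.support with i ∈ H, a i ^ m i) := by
  rw [fixVars, MvPolynomial.bind₁_monomial]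
  rw [MvPolynomial.monomial_eq, Finsupp.prod, Finsupp.support_filter]
  simp only [ite_pow, prod_ite, map_mul, map_prod, map_pow, mul_assoc]
  congr 2
  exact prod_congr rfl fun i hi => by rw [Finsupp.filter_apply_pos (· ∉ H) _ (mem_filter.1 hi).2]

theorem exists_filter_eq_of_mem_support_fixVars {H : Finset σ} {a : σ → R} {p : MvPolynomial σ R}
    {m' : σ →₀ ℕ} (hm' : m' ∈ (fixVars H a p).support) :
    ∃ m ∈ p.support, m.filter (· ∉ H) = m' := by
  rw [p.as_sum, map_sum] at hm'
  obtain ⟨m, hm, hmem⟩ := mem_biUnion.1 (MvPolynomial.support_sum hm')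
  rw [fixVars_monomial] at hmem
  exact ⟨m, hm, (mem_singleton.1 (MvPolynomial.support_monomial_subset hmem)).symm⟩

/-- The monomials of maximal degree of a polynomial; fixing a variable in each of them lowers the
degree. -/
def maxonomials (p : MvPolynomial σ R) : Finset (σ →₀ ℕ) :=
  p.support.filter fun m => m.degree = p.totalDegree

theorem totalDegree_fixVars_lt {H : Finset σ} {p : MvPolynomial σ R} (a : σ → R)
    (hp : 0 < p.totalDegree) (hH : ∀ m ∈ maxonomials p, ¬Disjoint m.support H) :
    (fixVars H a p).totalDegree < p.totalDegree := by
  rw [MvPolynomial.totalDegree, Finset.sup_lt_iff hp]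
  intro m' hm'
  obtain ⟨m, hm, rfl⟩ := exists_filter_eq_of_mem_support_fixVars hm'
  have hsplit : (m.filter (· ∈ H)).degree + (m.filter (· ∉ H)).degree = m.degree := by
    rw [← map_add, Finsupp.filter_add_filter_not]
  have hle : m.degree ≤ p.totalDegree := MvPolynomial.le_totalDegree hm
  change (m.filter (· ∉ H)).degree < p.totalDegree
  by_cases hmax : m.degree = p.totalDegree
  · have hpos : (m.filter (· ∈ H)).degree ≠ 0 := by
      obtain ⟨i, hi, hiH⟩ := not_disjoint_iff.1 (hH m (mem_filter.2 ⟨hm, hmax⟩))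
      rw [Ne, Finsupp.degree_eq_zero_iff]
      exact fun h => Finsupp.mem_support_iff.1 hi <| by
        simpa [Finsupp.filter_apply, hiH] using DFunLike.congr_fun h i
    lia
  · lia

end Fix

section Disjoint

theorem exists_maximal_pairwiseDisjoint {ι α : Type*} [DecidableEq α] (s : Finset ι)
    (B : ι → Finset α) (hB : ∀ a ∈ s, (B a).Nonempty) :
    ∃ F ⊆ s, (F : Set ι).PairwiseDisjoint B ∧ ∀ a ∈ s, ¬Disjoint (B a) (F.biUnion B) := by
  classical
  let families : Finset (Finset ι) :=
    s.powerset.filter fun F : Finset ι => (F : Set ι).PairwiseDisjoint B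
  obtain ⟨F, hF⟩ := families.exists_maximal ⟨∅, by simp [families]⟩
  obtain ⟨hFs, hFdisj⟩ := mem_filter.1 hF.prop
  rw [mem_powerset] at hFs
  refine ⟨F, hFs, hFdisj, fun a ha hdisj => ?_⟩
  rw [disjoint_biUnion_right] at hdisj
  have hins : insert a F ∈ families := by
    refine mem_filter.2 ⟨mem_powerset.2 (insert_subset ha hFs), ?_⟩
    rw [coe_insert]
    exact hFdisj.insert fun b hb _ => hdisj b hb
  have haF : a ∈ F := hF.le_of_ge hins (subset_insert a F) (mem_insert_self a F)
  exact (hB a ha).ne_empty (disjoint_self.1 (hdisj a haF))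

end Disjoint

section Cube

variable {n : ℕ} {ε : ℝ} {f : BoolFun n} {p q : MvPolynomial (Fin n) ℝ}

/-- The function obtained from `f` by fixing the bits in `H` to those of `z`; it still takes `n`
bits and ignores those in `H`. -/
def fixBits (f : BoolFun n) (H : Finset (Fin n)) (z : Fin n → Bool) : BoolFun n :=
  fun x => f (H.piecewise z x)

theorem fixBits_empty (f : BoolFun n) (z : Fin n → Bool) : fixBits f ∅ z = f :=
  funext fun x => by rw [fixBits, piecewise_empty]

theorem point_piecewise (H : Finset (Fin n)) (z x : Fin n → Bool) :
    point (H.piecewise z x) = H.piecewise (point z) (point x) := by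
  ext i
  by_cases hi : i ∈ H <;> simp [point, hi]

theorem eval_point_fixVars (H : Finset (Fin n)) (z x : Fin n → Bool)
    (p : MvPolynomial (Fin n) ℝ) :
    (fixVars H (point z) p).eval (point x) = p.eval (point (H.piecewise z x)) := by
  rw [eval_fixVars, point_piecewise]

theorem isMultilinear_iff_forall_mem_support : IsMultilinear p ↔ ∀ m ∈ p.support, ∀ i, m i ≤ 1 := by
  simp only [IsMultilinear, MvPolynomial.degreeOf_le_iff]
  exact ⟨fun h m hm i => h i m hm, fun h i m hm => h m hm i⟩

theorem IsMultilinear.fixVars (hp : IsMultilinear p) (H : Finset (Fin n)) (a : Fin n → ℝ) :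
    IsMultilinear (fixVars H a p) := by
  rw [isMultilinear_iff_forall_mem_support] at hp ⊢
  intro m' hm' i
  obtain ⟨m, hm, rfl⟩ := exists_filter_eq_of_mem_support_fixVars hm'
  rw [Finsupp.filter_apply]
  split_ifs
  · exact zero_le_one
  · exact hp m hm i

theorem IsNondetRep.fixBits (hq : IsNondetRep f q) (H : Finset (Fin n)) (z : Fin n → Bool) :
    IsNondetRep (fixBits f H z) (BooleanComplexity.fixVars H (point z) q) :=
  ⟨hq.1.fixVars H _, fun x => by rw [eval_point_fixVars]; exact hq.2 _⟩

theorem IsApproxNondetRep.fixBits (hp : IsApproxNondetRep ε f p) (H : Finset (Fin n))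
    (z : Fin n → Bool) :
    IsApproxNondetRep ε (fixBits f H z) (BooleanComplexity.fixVars H (point z) p) :=
  fun x => by rw [eval_point_fixVars]; exact hp _

theorem exists_eval_ne_zero_of_mem_maxonomials (hq : IsMultilinear q) {m : Fin n →₀ ℕ}
    (hm : m ∈ maxonomials q) (x : Fin n → Bool) :
    ∃ y, (∀ i ∉ m.support, y i = x i) ∧ q.eval (point y) ≠ 0 := by
  obtain ⟨hsupp, hdeg⟩ := mem_filter.1 hm
  let S (i : Fin n) : Finset ℝ := if i ∈ m.support then {0, 1} else {point x i}
  have hS (i : Fin n) : m i < #(S i) := by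
    by_cases hi : i ∈ m.support
    · have := isMultilinear_iff_forall_mem_support.1 hq m hsupp i
      simp only [S, if_pos hi, card_pair zero_ne_one]
      lia
    · simp only [S, if_neg hi, card_singleton, Finsupp.notMem_support_iff.1 hi, zero_lt_one]
  obtain ⟨s, hs, hsq⟩ := MvPolynomial.combinatorial_nullstellensatz_exists_eval_nonzero q m
    (MvPolynomial.mem_support_iff.1 hsupp) hdeg.symm S hS
  have hbit (i : Fin n) :
      ∃ b : Bool, (i ∉ m.support → b = x i) ∧ (if b then (1 : ℝ) else 0) = s i := by
    by_cases hi : i ∈ m.support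
    · have hsi : s i = 0 ∨ s i = 1 := by
        simpa only [S, if_pos hi, mem_insert, mem_singleton] using hs i
      rcases hsi with h | h
      · exact ⟨false, fun h' => absurd hi h', by simp [h]⟩
      · exact ⟨true, fun h' => absurd hi h', by simp [h]⟩
    · have hsi : s i = point x i := by
        simpa only [S, if_neg hi, mem_singleton] using hs i
      exact ⟨x i, fun _ => rfl, hsi.symm⟩
  choose y hyx hys using hbit
  have hpoint : point y = s := funext hys
  exact ⟨y, hyx, hpoint ▸ hsq⟩

theorem exists_point_eq_add_sum {ι : Type*} {B : ι → Finset (Fin n)} {x : Fin n → Bool}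
    {y : ι → Fin n → Bool} (hB : Pairwise (Function.onFun Disjoint B))
    (hy : ∀ j, ∀ i ∉ B j, y j i = x i) (A : Finset ι) :
    ∃ z, point z = point x + ∑ j ∈ A, (point (y j) - point x) := by
  have hbit (i : Fin n) : ∃ b : Bool,
      (if b then (1 : ℝ) else 0) = point x i + ∑ j ∈ A, (point (y j) i - point x i) := by
    by_cases hi : ∃ j ∈ A, i ∈ B j
    · obtain ⟨j, hj, hij⟩ := hi
      refine ⟨y j i, ?_⟩
      rw [sum_eq_single_of_mem j hj fun k _ hkj => ?_, add_sub_cancel]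
      · rfl
      · have : i ∉ B k := fun hik => disjoint_left.1 (hB hkj) hik hij
        simp [point, hy k i this]
    · push Not at hi
      refine ⟨x i, ?_⟩
      rw [sum_eq_zero fun j hj => ?_, add_zero]
      · rfl
      · simp [point, hy j i (hi j hj)]
  choose z hz using hbit
  exact ⟨z, funext fun i => by rw [Pi.add_apply, Finset.sum_apply]; exact hz i⟩

theorem card_mul_one_sub_le_of_pairwise_disjoint {ι : Type*} [Fintype ι]
    {B : ι → Finset (Fin n)} {x : Fin n → Bool} {y : ι → Fin n → Bool}
    (hB : Pairwise (Function.onFun Disjoint B))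
    (hy : ∀ j, ∀ i ∉ B j, y j i = x i) (hx : 0 < |p.eval (point x)|)
    (hmax : ∀ z, |p.eval (point z)| ≤ |p.eval (point x)|)
    (hpy : ∀ j, |p.eval (point (y j))| ≤ ε * |p.eval (point x)|) :
    Fintype.card ι * (1 - ε) ≤ 2 * p.totalDegree ^ 2 := by
  set M := |p.eval (point x)| with hM
  have hmarkov : |∑ j, (p.eval (point (y j)) - p.eval (point x))| ≤ 2 * p.totalDegree ^ 2 * M := by
    have hcube (A : Finset ι) : |p.eval (point x + ∑ j ∈ A, (point (y j) - point x))| ≤ M := by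
      obtain ⟨z, hz⟩ := exists_point_eq_add_sum hB hy A
      exact hz ▸ hmax z
    simpa only [add_sub_cancel] using abs_sum_eval_add_sub_le hx hcube
  have hsum : |∑ j, p.eval (point (y j))| ≤ Fintype.card ι * (ε * M) := by
    refine (abs_sum_le_sum_abs _ _).trans ((sum_le_card_nsmul _ _ _ fun j _ => hpy j).trans_eq ?_)
    rw [nsmul_eq_mul, card_univ]
  refine le_of_mul_le_mul_right ?_ hx
  calc Fintype.card ι * (1 - ε) * M
      = |Fintype.card ι * p.eval (point x)| - Fintype.card ι * (ε * M) := by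
        rw [abs_mul, Nat.abs_cast, ← hM]; ring
    _ ≤ |Fintype.card ι * p.eval (point x)| - |∑ j, p.eval (point (y j))| := by gcongr
    _ ≤ |∑ j, (p.eval (point (y j)) - p.eval (point x))| := by
        rw [sum_sub_distrib, sum_const, nsmul_eq_mul, card_univ, abs_sub_comm]
        exact abs_sub_abs_le_abs_sub _ _
    _ ≤ 2 * p.totalDegree ^ 2 * M := hmarkov

theorem IsApproxNondetRep.exists_forall_abs_eval_le (hp : IsApproxNondetRep ε f p) (hε1 : ε < 1)
    (hf : ∃ x, f x = true) :
    ∃ x, f x = true ∧ ∀ z, |p.eval (point z)| ≤ |p.eval (point x)| := by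
  obtain ⟨w, hw⟩ := hf
  obtain ⟨x, hmax⟩ := Finite.exists_max fun z => |p.eval (point z)|
  refine ⟨x, ?_, hmax⟩
  by_contra hx
  have := (hp x).1 (Bool.eq_false_of_not_eq_true hx)
  linarith [(hp w).2 hw, hmax w]

theorem card_le_of_pairwiseDisjoint_maxonomials (hε0 : 0 ≤ ε) (hε1 : ε < 1)
    (hp : IsApproxNondetRep ε f p) (hq : IsNondetRep (neg f) q) (hf : ∃ x, f x = true)
    {F : Finset (Fin n →₀ ℕ)} (hF : F ⊆ maxonomials q)
    (hdisj : (F : Set (Fin n →₀ ℕ)).PairwiseDisjoint Finsupp.support) :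
    (#F : ℝ) ≤ 2 * p.totalDegree ^ 2 / (1 - ε) := by
  obtain ⟨x, hx, hmax⟩ := hp.exists_forall_abs_eval_le hε1 hf
  have hpx : 1 ≤ |p.eval (point x)| := (hp x).2 hx
  have hchange (m : F) := exists_eval_ne_zero_of_mem_maxonomials hq.1 (hF m.2) x
  choose y hyx hqy using hchange
  have hpy (m : F) : |p.eval (point (y m))| ≤ ε * |p.eval (point x)| := by
    have hfy : f (y m) = false := by simpa [neg] using (hq.2 (y m)).1 (hqy m)
    exact ((hp _).1 hfy).trans (le_mul_of_one_le_right hε0 hpx)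
  rw [le_div_iff₀ (sub_pos.2 hε1), ← Fintype.card_coe F]
  refine card_mul_one_sub_le_of_pairwise_disjoint (B := fun m : F => m.1.support)
    (fun m m' h => ?_) hyx (zero_lt_one.trans_le hpx) hmax hpy
  exact hdisj m.2 m'.2 (Subtype.coe_ne_coe.2 h)

theorem exists_totalDegree_fixVars_lt (hε0 : 0 ≤ ε) (hε1 : ε < 1)
    (hp : IsApproxNondetRep ε f p) (hq : IsNondetRep (neg f) q) (hf : ∃ x, f x = true)
    (hdeg : 0 < q.totalDegree) :
    ∃ H : Finset (Fin n), (#H : ℝ) ≤ q.totalDegree * (2 * p.totalDegree ^ 2 / (1 - ε)) ∧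
      ∀ a, (fixVars H a q).totalDegree < q.totalDegree := by
  have hnonempty : ∀ m ∈ maxonomials q, m.support.Nonempty := fun m hm => by
    rw [Finsupp.support_nonempty_iff]
    rintro rfl
    simp [← (mem_filter.1 hm).2] at hdeg
  obtain ⟨F, hF, hdisj, hhit⟩ := exists_maximal_pairwiseDisjoint _ Finsupp.support hnonempty
  have hF_card := card_le_of_pairwiseDisjoint_maxonomials hε0 hε1 hp hq hf hF hdisj
  have hsupport : ∀ m ∈ F, #m.support ≤ q.totalDegree := fun m hm => by
    rw [← (mem_filter.1 (hF hm)).2]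
    exact card_support_le_degree m
  refine ⟨F.biUnion Finsupp.support, ?_, fun a => totalDegree_fixVars_lt a hdeg hhit⟩
  calc (#(F.biUnion Finsupp.support) : ℝ) ≤ #F * q.totalDegree := by
        exact_mod_cast card_biUnion_le_card_mul _ _ _ hsupport
    _ ≤ q.totalDegree * (2 * p.totalDegree ^ 2 / (1 - ε)) := by
        rw [mul_comm]; gcongr

end Cube

section Depth

variable {n : ℕ} {f : BoolFun n}

theorem DecisionTree.Computes.D_le {T : DecisionTree n} (hT : T.Computes f) : D f ≤ T.depth :=
  Nat.sInf_le ⟨T, hT, rfl⟩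

theorem exists_computes_depth_eq_D (f : BoolFun n) :
    ∃ T : DecisionTree n, T.Computes f ∧ T.depth = D f := by
  obtain ⟨T, hT⟩ := exists_decisionTree f
  exact Nat.sInf_mem (s := {d | ∃ T : DecisionTree n, T.Computes f ∧ T.depth = d})
    ⟨T.depth, T, hT, rfl⟩

theorem D_eq_zero_of_forall_eq {b : Bool} (hf : ∀ x, f x = b) : D f = 0 :=
  Nat.le_zero.1 (DecisionTree.Computes.D_le (T := .leaf b) fun x => (hf x).symm)

theorem exists_D_le_D_fixBits_singleton_add_one (f : BoolFun n) (i : Fin n) :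
    ∃ z, D f ≤ D (fixBits f {i} z) + 1 := by
  obtain ⟨T₀, hT₀, hd₀⟩ := exists_computes_depth_eq_D (fixBits f {i} fun _ => false)
  obtain ⟨T₁, hT₁, hd₁⟩ := exists_computes_depth_eq_D (fixBits f {i} fun _ => true)
  have hself (x : Fin n → Bool) (b : Bool) (hb : x i = b) :
      fixBits f {i} (fun _ => b) x = f x := by
    rw [fixBits, piecewise_singleton, ← hb, Function.update_eq_self]
  have hT : (DecisionTree.query i T₀ T₁).Computes f := fun x => by
    cases hx : x i
    · simpa [DecisionTree.eval, hx, hself x _ hx] using hT₀ x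
    · simpa [DecisionTree.eval, hx, hself x _ hx] using hT₁ x
  have hD : D f ≤ max T₀.depth T₁.depth + 1 := hT.D_le
  rcases le_total T₀.depth T₁.depth with h | h
  · exact ⟨_, by rwa [max_eq_right h, hd₁] at hD⟩
  · exact ⟨_, by rwa [max_eq_left h, hd₀] at hD⟩

theorem fixBits_fixBits_singleton (f : BoolFun n) (i : Fin n) (H : Finset (Fin n))
    (w z : Fin n → Bool) :
    fixBits (fixBits f {i} w) H z = fixBits f (insert i H) (Function.update z i (w i)) := by
  funext x
  rw [fixBits, fixBits, fixBits, piecewise_singleton]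
  congr 1
  ext j
  rcases eq_or_ne j i with rfl | hj
  · simp
  · by_cases hjH : j ∈ H <;> simp [hj, hjH]

theorem exists_D_le_D_fixBits_add_card (f : BoolFun n) (H : Finset (Fin n)) :
    ∃ z, D f ≤ D (fixBits f H z) + #H := by
  induction H using Finset.induction_on generalizing f with
  | empty => exact ⟨fun _ => false, by simp [fixBits_empty]⟩
  | insert i H hi ih =>
    obtain ⟨w, hw⟩ := exists_D_le_D_fixBits_singleton_add_one f i
    obtain ⟨z, hz⟩ := ih (fixBits f {i} w)
    rw [fixBits_fixBits_singleton] at hz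
    exact ⟨Function.update z i (w i), by rw [card_insert_of_notMem hi]; lia⟩

theorem neg_neg (f : BoolFun n) : neg (neg f) = f :=
  funext fun x => Bool.not_not (f x)

/-- The decision tree with its outputs negated, computing `¬f` if the given tree computes `f`. -/
def DecisionTree.negate : DecisionTree n → DecisionTree n
  | .leaf b => .leaf (!b)
  | .query i s t => .query i s.negate t.negate

theorem DecisionTree.depth_negate (T : DecisionTree n) : T.negate.depth = T.depth := by
  induction T with
  | leaf b => rfl
  | query i s t hs ht => rw [negate, depth, depth, hs, ht]

theorem DecisionTree.eval_negate (x : Fin n → Bool) (T : DecisionTree n) :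
    T.negate.eval x = !(T.eval x) := by
  induction T with
  | leaf b => rfl
  | query i s t hs ht =>
    rw [negate, eval, eval, hs, ht]
    split_ifs <;> rfl

theorem D_neg_le (f : BoolFun n) : D (neg f) ≤ D f := by
  obtain ⟨T, hT, hd⟩ := exists_computes_depth_eq_D f
  have hneg : T.negate.Computes (neg f) := fun x => by rw [T.eval_negate, hT x, neg]
  exact hneg.D_le.trans_eq (T.depth_negate.trans hd)

theorem D_neg (f : BoolFun n) : D (neg f) = D f :=
  (D_neg_le f).antisymm (by simpa only [neg_neg] using D_neg_le (neg f))

end Depth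

section Bound

variable {n : ℕ} {ε : ℝ} {f : BoolFun n} {p q : MvPolynomial (Fin n) ℝ}

theorem exists_forall_eq_of_totalDegree_eq_zero (hq : IsNondetRep f q) (hdeg : q.totalDegree = 0) :
    ∃ b, ∀ x, f x = b := by
  refine ⟨f fun _ => false, fun x => ?_⟩
  rw [MvPolynomial.totalDegree_eq_zero_iff_eq_C] at hdeg
  have heval := hq.2
  rw [hdeg] at heval
  simp only [MvPolynomial.eval_C] at heval
  exact Bool.eq_iff_iff.2 ((heval x).symm.trans (heval _))

theorem exists_D_le_D_fixBits_add (hε0 : 0 ≤ ε) (hε1 : ε < 1) (hp : IsApproxNondetRep ε f p)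
    (hq : IsNondetRep (neg f) q) (hf : ¬∃ b, ∀ x, f x = b) :
    ∃ H z, (D f : ℝ) ≤ D (fixBits f H z) + q.totalDegree * (2 * p.totalDegree ^ 2 / (1 - ε)) ∧
      (fixVars H (point z) q).totalDegree < q.totalDegree := by
  have htrue : ∃ x, f x = true := by
    by_contra! h
    exact hf ⟨false, fun x => Bool.eq_false_of_not_eq_true (h x)⟩
  have hdeg : 0 < q.totalDegree := by
    refine Nat.pos_of_ne_zero fun h0 => ?_
    obtain ⟨b, hb⟩ := exists_forall_eq_of_totalDegree_eq_zero hq h0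
    exact hf ⟨!b, fun x => Bool.not_eq_eq_eq_not.1 (hb x)⟩
  obtain ⟨H, hH, hlt⟩ := exists_totalDegree_fixVars_lt hε0 hε1 hp hq htrue hdeg
  obtain ⟨z, hz⟩ := exists_D_le_D_fixBits_add_card f H
  have hz' : (D f : ℝ) ≤ D (fixBits f H z) + #H := mod_cast hz
  exact ⟨H, z, hz'.trans (by gcongr), hlt _⟩

theorem D_le_of_isNondetRep {d : ℕ} (hε0 : 0 ≤ ε) (hε1 : ε < 1) (hp : IsApproxNondetRep ε f p)
    (hd : p.totalDegree ≤ d) (hq : IsNondetRep (neg f) q) :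
    (D f : ℝ) ≤ q.totalDegree ^ 2 * (2 * d ^ 2 / (1 - ε)) := by
  have hε : 0 ≤ 1 - ε := sub_nonneg.2 hε1.le
  have hbound : 0 ≤ 2 * (d : ℝ) ^ 2 / (1 - ε) := div_nonneg (by positivity) hε
  induction hk : q.totalDegree using Nat.strong_induction_on generalizing f p q with
  | _ k ih =>
  by_cases hconst : ∃ b, ∀ x, f x = b
  · obtain ⟨b, hb⟩ := hconst
    rw [D_eq_zero_of_forall_eq hb, Nat.cast_zero]
    exact mul_nonneg (sq_nonneg _) hbound
  obtain ⟨H, z, hz, hlt⟩ := exists_D_le_D_fixBits_add hε0 hε1 hp hq hconst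
  rw [hk] at hz hlt
  set e := (fixVars H (point z) q).totalDegree
  have hrec : (D (fixBits f H z) : ℝ) ≤ e ^ 2 * (2 * d ^ 2 / (1 - ε)) :=
    ih e hlt (hp.fixBits H z) ((totalDegree_fixVars_le H _ p).trans hd) (hq.fixBits H z) rfl
  have hquery : 2 * (p.totalDegree : ℝ) ^ 2 / (1 - ε) ≤ 2 * d ^ 2 / (1 - ε) :=
    div_le_div_of_nonneg_right (by gcongr) hε
  have hsq : (e : ℝ) ^ 2 + k ≤ k ^ 2 := by
    exact_mod_cast (show e ^ 2 + k ≤ k ^ 2 by nlinarith)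
  calc (D f : ℝ) ≤ D (fixBits f H z) + k * (2 * p.totalDegree ^ 2 / (1 - ε)) := hz
    _ ≤ e ^ 2 * (2 * d ^ 2 / (1 - ε)) + k * (2 * d ^ 2 / (1 - ε)) :=
        add_le_add hrec (mul_le_mul_of_nonneg_left hquery k.cast_nonneg)
    _ = (e ^ 2 + k) * (2 * d ^ 2 / (1 - ε)) := (add_mul _ _ _).symm
    _ ≤ k ^ 2 * (2 * d ^ 2 / (1 - ε)) := mul_le_mul_of_nonneg_right hsq hbound

theorem D_le (hε0 : 0 ≤ ε) (hε1 : ε < 1) (f : BoolFun n) :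
    (D f : ℝ) ≤ 2 / (1 - ε) * (approxNdeg ε f : ℝ) ^ 2 * (ndeg (neg f) : ℝ) ^ 2 := by
  obtain ⟨p, hp, hpd⟩ : approxNdeg ε f ∈ {d | ∃ p, IsApproxNondetRep ε f p ∧ p.totalDegree = d} :=
    Nat.sInf_mem ((exists_approxNondetRep hε0 f).imp' _ fun p hp => ⟨p, hp, rfl⟩)
  obtain ⟨q, hq, hqd⟩ : ndeg (neg f) ∈ {d | ∃ q, IsNondetRep (neg f) q ∧ q.totalDegree = d} :=
    Nat.sInf_mem ((exists_nondetRep (neg f)).imp' _ fun q hq => ⟨q, hq, rfl⟩)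
  calc (D f : ℝ) ≤ q.totalDegree ^ 2 * (2 * p.totalDegree ^ 2 / (1 - ε)) :=
        D_le_of_isNondetRep hε0 hε1 hp le_rfl hq
    _ = 2 / (1 - ε) * (approxNdeg ε f : ℝ) ^ 2 * (ndeg (neg f) : ℝ) ^ 2 := by
        rw [hpd, hqd]; ring

end Bound

end BooleanComplexity

end

theorem mainTheorem9 (ε : ℝ) (hε0 : 0 ≤ ε) (hε1 : ε < 1) :
    ∃ C : ℝ, ∀ (n : ℕ) (_hn : 0 < n) (f : BooleanComplexity.BoolFun n),
      (BooleanComplexity.D f : ℝ) ≤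
        C * (BooleanComplexity.approxNdeg ε f : ℝ) ^ 2 *
          (BooleanComplexity.ndeg (BooleanComplexity.neg f) : ℝ) ^ 2 ∧
      (BooleanComplexity.D f : ℝ) ≤
        C * (BooleanComplexity.ndeg f : ℝ) ^ 2 *
          (BooleanComplexity.approxNdeg ε (BooleanComplexity.neg f) : ℝ) ^ 2 := by
  refine ⟨2 / (1 - ε), fun n _ f => ⟨BooleanComplexity.D_le hε0 hε1 f, ?_⟩⟩
  have hneg := BooleanComplexity.D_le hε0 hε1 (BooleanComplexity.neg f)
  rwa [BooleanComplexity.D_neg, BooleanComplexity.neg_neg, mul_right_comm] at hneg
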